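/- **Thermalization of the free Fermi gas in one dimension.** Let $L$ be a prime number and let $\Lambda=\{1,\dots,L\}\cong\mathbb{Z}/L\mathbb{Z}$ be the one-dimensional lattice with periodic boundary conditions. Let $N$ be an integer with $46\le N<L/4$, and let $\mathcal{H}$ be the $N$-particle sector of the fermionic Fock space over $\Lambda$, so that $\dim\mathcal{H}=\binom{L}{N}$. With $c_x^\dagger$, $c_x$ the fermionic creation and annihilation operators at the site $x\in\Lambda$, consider on $\mathcal{H}$ the Hamiltonian $$H_0^{\mathrm{fF}}=-\sum_{\substack{x,y\in\Lambda\\ \mathrm{dist}(x,y)=1}}c_x^\dagger c_y .$$ Let $\Gamma\subseteq\Lambda$ be an interval of the periodic lattice (a set of consecutive sites modulo $L$), let $\mu=|\Gamma|/L$ and $N_\Gamma=\sum_{x\in\Gamma}c_x^\dagger c_x$, and let $\eta>\frac{2(\ln N+1)}{N}$. Let $$P_{\mathrm{eq},\eta}=\mathbf{1}_{[N(\mu-\eta),\,N(\mu+\eta)]}(N_\Gamma)$$ be the spectral projection of $N_\Gamma$ for the condition $\left|\frac{N_\Gamma}{N}-\mu\right|\le\eta$, and let $P_{\mathrm{neq},\eta}=I-P_{\mathrm{eq},\eta}$.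 Let $\varepsilon,\delta>0$ be such that $\varepsilon\delta\ge\frac{32\ln N}{\eta^2N}$. Then for every $\psi_0\in\mathcal{H}$ with $\|\psi_0\|=1$, the evolved state $\psi_t=e^{-iH_0^{\mathrm{fF}}t}\psi_0$ satisfies $\|P_{\mathrm{neq},\eta}\psi_t\|^2<\varepsilon$ for $(1-\delta)$-most $t\in[0,\infty)$, that is, $$\liminf_{T\to\infty}\frac1T\,\Bigl|\bigl\{t\in[0,T]:\|P_{\mathrm{neq},\eta}\psi_t\|^2<\varepsilon\bigr\}\Bigr|\ \ge\ 1-\delta ,$$ where $|\cdot|$ denotes Lebesgue measure. -/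

import Mathlib

open Filter MeasureTheory

namespace FreeFermi

noncomputable section

/-- Fermionic Fock space over the one-dimensional lattice with `L` sites, in the occupation number
representation: the basis vector indexed by a finite set `S = {x₁ < ⋯ < x_n}` of sites is
`c†_{x₁} ⋯ c†_{x_n} Φ_vac`. -/
abbrev Fock (L : ℕ) : Type := EuclideanSpace ℂ (Finset (Fin L))

/-- The fermionic sign `(-1) ^ #{y ∈ S | y < x}`. -/
def fermiSign {L : ℕ} (x : Fin L) (S : Finset (Fin L)) : ℂ :=
  (-1) ^ (S.filter (fun y => y < x)).card

/-- The annihilation operator `c_x`. It maps the basis vector of `S` to `fermiSign x S` times the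
basis vector of `S \ {x}` if `x ∈ S`, and to `0` if `x ∉ S`. -/
def annihilation {L : ℕ} (x : Fin L) : Fock L →L[ℂ] Fock L :=
  LinearMap.toContinuousLinearMap
    { toFun := fun ψ => WithLp.toLp 2 fun S =>
        if x ∈ S then 0 else fermiSign x S * ψ (insert x S)
      map_add' := by
        intro φ ψ
        ext S
        by_cases h : x ∈ S <;> simp [h, mul_add]
      map_smul' := by
        intro a ψ
        ext S
        by_cases h : x ∈ S <;> simp [h, mul_left_comm] }

/-- The creation operator `c†_x`, the Hilbert space adjoint of `c_x`. -/
def creation {L : ℕ} (x : Fin L) : Fock L →L[ℂ] Fock L :=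
  ContinuousLinearMap.adjoint (annihilation x)

/-- The `N`-particle sector of Fock space. -/
def sector (L N : ℕ) : Submodule ℂ (Fock L) where
  carrier := {ψ | ∀ S : Finset (Fin L), S.card ≠ N → ψ S = 0}
  zero_mem' := by intro S _; rfl
  add_mem' := by
    intro φ ψ hφ hψ S hS
    simp [hφ S hS, hψ S hS]
  smul_mem' := by
    intro a ψ hψ S hS
    simp [hψ S hS]

theorem annihilation_apply {L : ℕ} (x : Fin L) (ψ : Fock L) (S : Finset (Fin L)) :
    annihilation x ψ S = if x ∈ S then 0 else fermiSign x S * ψ (insert x S) := rfl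

theorem creation_apply {L : ℕ} (x : Fin L) (ψ : Fock L) (S : Finset (Fin L)) :
    creation x ψ S = if x ∈ S then fermiSign x S * ψ (S.erase x) else 0 := by
  have h1 : creation x ψ S = inner ℂ (EuclideanSpace.single S (1 : ℂ)) (creation x ψ) := by
    simp [EuclideanSpace.inner_single_left]
  rw [h1, creation, ContinuousLinearMap.adjoint_inner_right, PiLp.inner_apply]
  simp only [annihilation_apply, RCLike.inner_apply]
  by_cases hx : x ∈ S
  · rw [Finset.sum_eq_single (S.erase x)]
    · have hs : fermiSign x (S.erase x) = fermiSign x S := by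
        unfold fermiSign
        congr 2
        ext y
        simp only [Finset.mem_filter, Finset.mem_erase]
        constructor
        · rintro ⟨⟨_, h⟩, h'⟩; exact ⟨h, h'⟩
        · rintro ⟨h, h'⟩; exact ⟨⟨h'.ne, h⟩, h'⟩
      simp [hx, hs, Finset.insert_erase hx]
      simp [fermiSign, mul_comm]
    · intro T _ hT
      by_cases hxT : x ∈ T
      · simp [hxT]
      · have : insert x T ≠ S := by
          rintro rfl
          exact hT (Finset.erase_insert hxT).symm
        simp [hxT, this]
    · simp
  · rw [if_neg hx]
    refine Finset.sum_eq_zero fun T _ => ?_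
    by_cases hxT : x ∈ T
    · simp [hxT]
    · have : insert x T ≠ S := by
        rintro rfl
        exact hx (Finset.mem_insert_self x T)
      simp [hxT, this]

/-- Each hopping term `c†_x c_y` preserves the particle number. -/
theorem hop_mem_sector {L N : ℕ} (x y : Fin L) {ψ : Fock L} (hψ : ψ ∈ sector L N) :
    (creation x ∘L annihilation y) ψ ∈ sector L N := by
  intro S hS
  rw [ContinuousLinearMap.comp_apply, creation_apply]
  by_cases hx : x ∈ S
  · rw [if_pos hx, annihilation_apply]
    by_cases hy : y ∈ S.erase x
    · simp [hy]
    · rw [if_neg hy, hψ, mul_zero, mul_zero]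
      rw [Finset.card_insert_of_notMem hy, Finset.card_erase_add_one hx]
      exact hS
  · rw [if_neg hx]

/-- The Hilbert space of the system: the `N`-particle sector of Fock space. -/
abbrev Space (L N : ℕ) : Type := sector L N

/-- The operator `c†_x c_y` on the `N`-particle sector. -/
def hop {L : ℕ} (N : ℕ) (x y : Fin L) : Space L N →L[ℂ] Space L N :=
  ((creation x ∘L annihilation y) ∘L (sector L N).subtypeL).codRestrict (sector L N)
    fun ψ => hop_mem_sector x y ψ.2

/-- The distance of two sites of the lattice with periodic boundary conditions
(the subtractions are modulo `L`). -/
def latticeDist {L : ℕ} (x y : Fin L) : ℕ := min (x - y : Fin L).val (y - x : Fin L).val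

/-- The Hamiltonian `H₀ = - ∑_{dist(x,y) = 1} c†_x c_y` of the free Fermi gas. -/
def hamiltonian (L N : ℕ) : Space L N →L[ℂ] Space L N :=
  - ∑ x : Fin L, ∑ y : Fin L, if latticeDist x y = 1 then hop N x y else 0

/-- The operator `N_Γ = ∑_{x ∈ Γ} c†_x c_x` of the number of particles in the region `Γ`. -/
def numberIn {L : ℕ} (N : ℕ) (Γ : Finset (Fin L)) : Space L N →L[ℂ] Space L N :=
  ∑ x ∈ Γ, hop N x x

/-- The spectral projection `1_s(A)` of a self-adjoint operator `A` on a finite-dimensional Hilbert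
space: the orthogonal projection onto the span of the eigenspaces of `A` with eigenvalue in `s`. -/
def spectralProjection {E : Type*} [NormedAddCommGroup E] [InnerProductSpace ℂ E]
    [FiniteDimensional ℂ E] (A : E →L[ℂ] E) (s : Set ℝ) : E →L[ℂ] E :=
  (⨆ ν ∈ s, Module.End.eigenspace (A : E →ₗ[ℂ] E) (ν : ℂ)).starProjection

/-- The relative size `μ = |Γ| / |Λ|`. -/
def relSize {L : ℕ} (Γ : Finset (Fin L)) : ℝ := (Γ.card : ℝ) / (L : ℝ)

/-- `P_{eq,η} = 1_{[N(μ-η), N(μ+η)]}(N_Γ)`. -/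
def projEq {L : ℕ} (N : ℕ) (Γ : Finset (Fin L)) (η : ℝ) : Space L N →L[ℂ] Space L N :=
  spectralProjection (E := Space L N) (numberIn N Γ)
    (Set.Icc ((N : ℝ) * (relSize Γ - η)) ((N : ℝ) * (relSize Γ + η)))

/-- `P_{neq,η} = I - P_{eq,η}`. -/
def projNeq {L : ℕ} (N : ℕ) (Γ : Finset (Fin L)) (η : ℝ) : Space L N →L[ℂ] Space L N :=
  ContinuousLinearMap.id ℂ (Space L N) - projEq N Γ η

/-- `Γ` is an interval of the periodic lattice: it consists of the `m` consecutive sites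
`a, a + 1, …, a + m - 1` modulo `L`, for some `a` and `m` (`m = 0` and `m ≥ L` are allowed).
All sets of the form `{x | a ≤ x ≤ b}` are of this kind. -/
def IsInterval {L : ℕ} (Γ : Finset (Fin L)) : Prop :=
  ∃ a m : ℕ, ∀ x : Fin L, x ∈ Γ ↔ ∃ i < m, (a + i) % L = (x : ℕ)

/-- The time evolution `e^{-iHt} ψ₀`. -/
def evolve {E : Type*} [NormedAddCommGroup E] [InnerProductSpace ℂ E] [FiniteDimensional ℂ E]
    (H : E →L[ℂ] E) (t : ℝ) (ψ₀ : E) : E :=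
  NormedSpace.exp ((-(Complex.I * (t : ℂ))) • H) ψ₀

/-- `S t` holds for `(1 - δ)`-most `t ∈ [0, ∞)`. -/
def ForMostTimes (δ : ℝ) (S : ℝ → Prop) : Prop :=
  1 - δ ≤ liminf (fun T : ℝ => (1 / T) * (volume {t : ℝ | t ∈ Set.Icc 0 T ∧ S t}).toReal) atTop

end

end FreeFermi

namespace FreeFermi

/-! Let b_k = ∑_x e^{-2πikx/L} c_x be the plane-wave operators and e_k = -2cos(2πk/L) the
one-particle energies. Then L²(N_Γ - Nμ) = ∑_{k≠l} χ(l-k) b_k†b_l with χ the Fourier coefficients of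
Γ; the omitted diagonal k = l is exactly the mean L²Nμ. Since [H, b_k†b_l] = (e_k - e_l) b_k†b_l,
each term only acquires a phase in the Heisenberg picture, and the time average of ‖(N_Γ - Nμ)ψ_t‖²
couples only terms with equal gaps.

Primality of L enters here: the L-th roots of unity satisfy only the trivial rational relation, so a
non-zero gap fixes k and l up to sign (`eq_or_eq_neg_of_modeEnergy_sub_eq`) and is shared by at most
four terms (`exists_tendsto_average_numberMode`). The terms l = -k have gap zero and are bounded at
every time by Cauchy–Schwarz (`sq_sum_norm_numberMode_neg_le`).

Parseval, b_k b_k† ≤ L (Pauli principle) and ∑ b_k†b_k = LN bound both parts by multiples of L⁴N.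
The averaged variance is thus at most 10N instead of order N². Chebyshev's inequality for N_Γ and
Markov's inequality in t conclude, because 10 ≤ 32 ln N. -/

/-! ### Canonical anticommutation relations. -/

theorem fermiSign_mul_self {L : ℕ} (x : Fin L) (S : Finset (Fin L)) :
    fermiSign x S * fermiSign x S = 1 := by
  rw [fermiSign, ← pow_add]
  exact Even.neg_one_pow ⟨_, rfl⟩

theorem fermiSign_insert {L : ℕ} {x : Fin L} (y : Fin L) {S : Finset (Fin L)} (hx : x ∉ S) :
    fermiSign y (insert x S) = fermiSign y S * if x < y then -1 else 1 := by
  unfold fermiSign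
  rw [Finset.filter_insert]
  split_ifs with h
  · rw [Finset.card_insert_of_notMem (by simp [hx]), pow_succ]
  · simp

/-- Exactly one of `x < y` and `y < x` holds, so exactly one of the two insertions flips a sign. -/
theorem fermiSign_insert_antisymm {L : ℕ} {x y : Fin L} (hxy : x ≠ y) {S : Finset (Fin L)}
    (hx : x ∉ S) (hy : y ∉ S) :
    fermiSign x S * fermiSign y (insert x S) = -(fermiSign y S * fermiSign x (insert y S)) := by
  rw [fermiSign_insert y hx, fermiSign_insert x hy]
  rcases lt_or_gt_of_ne hxy with h | h
  · simp [h, h.not_gt]; ring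
  · simp [h, h.not_gt]; ring

theorem annihilation_mul_annihilation {L : ℕ} (x y : Fin L) :
    annihilation x * annihilation y = -(annihilation y * annihilation x) := by
  ext ψ S
  simp only [mul_apply_eq_comp, neg_apply, PiLp.neg_apply,
    annihilation_apply, Finset.mem_insert]
  by_cases hxy : x = y
  · subst hxy; simp
  by_cases hx : x ∈ S
  · simp [hx]
  by_cases hy : y ∈ S
  · simp [hy]
  have := fermiSign_insert_antisymm hxy hx hy
  rw [if_neg hx, if_neg hy, if_neg (by tauto), if_neg (by tauto), ← mul_assoc, ← mul_assoc, this,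
    Finset.insert_comm]
  ring

theorem creation_mul_creation {L : ℕ} (x y : Fin L) :
    creation x * creation y = -(creation y * creation x) := by
  have h := congrArg star (annihilation_mul_annihilation y x)
  rw [star_mul, star_neg (annihilation x * annihilation y), star_mul] at h
  exact h

theorem annihilation_mul_creation {L : ℕ} (x y : Fin L) :
    annihilation x * creation y = (if x = y then 1 else 0) - creation y * annihilation x := by
  ext ψ S
  simp only [mul_apply_eq_comp, sub_apply, PiLp.sub_apply,
    annihilation_apply, creation_apply, Finset.mem_insert]
  by_cases hxy : x = y
  · subst hxy
    by_cases hx : x ∈ S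
    · simp only [hx, if_true, Finset.notMem_erase, if_false, Finset.insert_erase]
      have h : fermiSign x S = fermiSign x (S.erase x) := by
        conv_lhs => rw [← Finset.insert_erase hx]
        simp [fermiSign_insert x (Finset.notMem_erase x S)]
      rw [h, ← mul_assoc, fermiSign_mul_self]
      simp
    · simp only [hx, if_false, true_or, if_true, Finset.erase_insert hx, sub_zero,
        fermiSign_insert x hx, lt_irrefl, mul_one]
      rw [← mul_assoc, fermiSign_mul_self]
      simp
  -- For x ≠ y both products vanish unless x ∉ S and y ∈ S; only that case needs a comparison of
  -- signs.
  by_cases hx : x ∈ S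
  · have : x ∈ S.erase y := by simp [hx, hxy]
    simp [hx, hxy, this]
  by_cases hy : y ∈ S
  · obtain ⟨R, hyR, rfl⟩ : ∃ R, y ∉ R ∧ insert y R = S :=
      ⟨S.erase y, Finset.notMem_erase y S, Finset.insert_erase hy⟩
    have hxR : x ∉ R := fun h => hx (Finset.mem_insert_of_mem h)
    have h1 : (insert x (insert y R)).erase y = insert x R := by
      rw [Finset.insert_comm, Finset.erase_insert]
      simp [hyR, Ne.symm hxy]
    rw [if_neg hx, if_pos (Or.inr hy), if_pos hy, Finset.erase_insert hyR, if_neg hxR, h1,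
      fermiSign_insert y hx, fermiSign_insert x hyR, fermiSign_insert y hyR]
    rcases lt_or_gt_of_ne hxy with h | h
    · simp [h, h.not_gt, hxy, mul_left_comm]
    · simp [h, h.not_gt, hxy, mul_left_comm]
  · simp [hx, hy, hxy, Ne.symm hxy]

/-! ### The Hamiltonian and number operators on the sector. -/

theorem hop_coe {L N : ℕ} (x y : Fin L) (ψ : Space L N) :
    ((hop N x y ψ : Space L N) : Fock L) = creation x (annihilation y ψ) := rfl

theorem inner_hop {L N : ℕ} (x y : Fin L) (φ ψ : Space L N) :
    inner ℂ (hop N x y φ : Fock L) (ψ : Fock L) = inner ℂ (φ : Fock L) (hop N y x ψ : Fock L) := by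
  rw [hop_coe, hop_coe, creation, creation, ContinuousLinearMap.adjoint_inner_left,
    ContinuousLinearMap.adjoint_inner_right]

theorem latticeDist_comm {L : ℕ} (x y : Fin L) : latticeDist x y = latticeDist y x :=
  min_comm _ _

theorem hamiltonian_coe {L N : ℕ} (ψ : Space L N) :
    (hamiltonian L N ψ : Fock L) =
      -∑ x, ∑ y, if latticeDist x y = 1 then (hop N x y ψ : Fock L) else 0 := by
  simp only [hamiltonian, neg_apply, sum_apply, Submodule.coe_neg, Submodule.coe_sum]
  congr 1
  refine Finset.sum_congr rfl fun x _ => Finset.sum_congr rfl fun y _ => ?_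
  split_ifs <;> rfl

theorem inner_hamiltonian {L N : ℕ} (φ ψ : Space L N) :
    inner ℂ (hamiltonian L N φ : Fock L) (ψ : Fock L) =
      inner ℂ (φ : Fock L) (hamiltonian L N ψ : Fock L) := by
  rw [hamiltonian_coe, hamiltonian_coe, inner_neg_left, inner_neg_right]
  simp_rw [sum_inner, inner_sum]
  rw [Finset.sum_comm]
  congr 1
  refine Finset.sum_congr rfl fun x _ => Finset.sum_congr rfl fun y _ => ?_
  rw [latticeDist_comm y x]
  split_ifs
  · exact inner_hop y x φ ψ
  · simp

/-- The two fermionic signs in c†_x c_x cancel, so the occupation basis diagonalizes the number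
operator. -/
theorem numberIn_apply {L N : ℕ} (Γ : Finset (Fin L)) (ψ : Space L N) (S : Finset (Fin L)) :
    (numberIn N Γ ψ : Fock L) S = ((Γ ∩ S).card : ℂ) * (ψ : Fock L) S := by
  have h (x : Fin L) : (hop N x x ψ : Fock L) S = if x ∈ S then (ψ : Fock L) S else 0 := by
    rw [hop_coe, creation_apply]
    split_ifs with hx
    · have h : fermiSign x S = fermiSign x (S.erase x) := by
        conv_lhs => rw [← Finset.insert_erase hx]
        simp [fermiSign_insert x (Finset.notMem_erase x S)]
      rw [annihilation_apply, if_neg (Finset.notMem_erase x S), h, ← mul_assoc,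
        fermiSign_mul_self, one_mul, Finset.insert_erase hx]
    · rfl
  rw [numberIn, sum_apply, Submodule.coe_sum, WithLp.ofLp_sum,
    Finset.sum_apply]
  simp_rw [h]
  rw [← Finset.sum_filter, Finset.sum_const, nsmul_eq_mul, Finset.filter_mem_eq_inter]

theorem numberIn_univ_coe {L N : ℕ} (ψ : Space L N) :
    (numberIn N Finset.univ ψ : Fock L) = (N : ℂ) • (ψ : Fock L) := by
  ext S
  rw [numberIn_apply, Finset.univ_inter, PiLp.smul_apply, smul_eq_mul]
  by_cases h : S.card = N
  · rw [h]
  · rw [ψ.2 S h, mul_zero, mul_zero]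

/-! ### Roots of unity and gaps of the one-particle spectrum. -/

section Characters

variable {L : ℕ}

theorem isPrimitiveRoot_stdAddChar_one [NeZero L] :
    IsPrimitiveRoot (ZMod.stdAddChar (1 : ZMod L)) L := by
  have h := ZMod.stdAddChar_coe (N := L) 1
  rw [Int.cast_one] at h
  rw [h]
  simpa using Complex.isPrimitiveRoot_exp L (NeZero.ne L)

/-- For a prime `L`, the only integer linear relations between the `L`-th roots of unity are the
multiples of the relation with all coefficients equal. -/
theorem eq_of_sum_mul_stdAddChar_eq_zero [NeZero L] (hL : L.Prime) (f : ZMod L → ℤ)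
    (h : ∑ j, (f j : ℂ) * ZMod.stdAddChar j = 0) (i j : ZMod L) : f i = f j := by
  obtain ⟨n, rfl⟩ : ∃ n, L = n + 1 := ⟨L - 1, by have := hL.pos; omega⟩
  refine (isPrimitiveRoot_stdAddChar_one.sum_eq_zero_iff_forall_eq_int hL f).mp ?_ i j
  rw [← h]
  refine Finset.sum_congr rfl fun (k : ZMod (n + 1)) _ => ?_
  rw [← AddChar.map_nsmul_eq_pow]
  congr 2
  rw [nsmul_eq_mul, mul_one]
  exact ZMod.natCast_zmod_val k

/-- The one-particle energy `-2 cos (2πk/L)`. -/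
noncomputable def modeEnergy [NeZero L] (k : ZMod L) : ℝ := -2 * (ZMod.stdAddChar k).re

theorem modeEnergy_coe [NeZero L] (k : ZMod L) :
    (modeEnergy k : ℂ) = -(ZMod.stdAddChar k + ZMod.stdAddChar (-k)) := by
  rw [AddChar.map_neg_eq_conj, Complex.add_conj, modeEnergy]
  push_cast
  ring

/-- For a prime `L`, a non-zero gap of the one-particle spectrum determines its two levels. -/
theorem eq_or_eq_neg_of_modeEnergy_sub_eq [NeZero L] (hL : L.Prime) {k l k' l' : ZMod L}
    (hkl : k ≠ l) (hkl' : k ≠ -l)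
    (h : modeEnergy k - modeEnergy l = modeEnergy k' - modeEnergy l') :
    (k' = k ∨ k' = -k) ∧ (l' = l ∨ l' = -l) := by
  let d (a j : ZMod L) : ℤ := if j = a then 1 else 0
  -- Each energy is minus a sum of two roots of unity, so equality of the gaps is an integer
  -- relation with coefficients `f`. These are all equal by primality and sum to zero, hence vanish.
  let f (j : ZMod L) : ℤ := d k j + d (-k) j - d l j - d (-l) j -
    (d k' j + d (-k') j - d l' j - d (-l') j)
  have hd : ∀ a, ∑ j, (d a j : ℂ) * ZMod.stdAddChar j = ZMod.stdAddChar a := by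
    intro a; simp [d]
  have hd' : ∀ a, ∑ j, d a j = 1 := by intro a; simp [d]
  have hf : ∑ j, (f j : ℂ) * ZMod.stdAddChar j = 0 := by
    have h' : (modeEnergy k : ℂ) - modeEnergy l = modeEnergy k' - modeEnergy l' := by
      exact_mod_cast h
    simp only [modeEnergy_coe] at h'
    simp only [f, Int.cast_add, Int.cast_sub, sub_mul, add_mul, Finset.sum_sub_distrib,
      Finset.sum_add_distrib, hd]
    linear_combination -h'
  have hf' : ∑ j, f j = 0 := by
    simp only [f, Finset.sum_sub_distrib, Finset.sum_add_distrib, hd']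
    norm_num
  have hzero : ∀ j, f j = 0 := by
    intro j
    have h1 : ∑ i, f i = ∑ _i : ZMod L, f j :=
      Finset.sum_congr rfl fun i _ => eq_of_sum_mul_stdAddChar_eq_zero hL f hf i j
    rw [hf', Finset.sum_const, nsmul_eq_mul, eq_comm] at h1
    refine (mul_eq_zero.mp h1).resolve_left ?_
    simp
    exact NeZero.ne L
  have hd0 : ∀ a j, 0 ≤ d a j := by intro a j; simp only [d]; split_ifs <;> norm_num
  have hd1 : ∀ a, d a a = 1 := by intro a; simp [d]
  have hdne : ∀ a j, j ≠ a → d a j = 0 := by intro a j hj; simp [d, hj]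
  constructor
  -- Otherwise nothing cancels the +1 contributed by `k`, and f(k) ≥ 1. The second half is the
  -- mirror image, with f(l) ≤ -1.
  · by_contra hc
    push Not at hc
    have h1 := hzero k
    have e1 := hdne l k hkl
    have e2 := hdne (-l) k hkl'
    have e3 := hdne k' k hc.1.symm
    have e4 := hdne (-k') k fun h => hc.2 (by rw [h, neg_neg])
    have := hd0 (-k) k
    have := hd0 l' k
    have := hd0 (-l') k
    have := hd1 k
    simp only [f] at h1
    omega
  · by_contra hc
    push Not at hc
    have h1 := hzero l
    have e1 := hdne k l hkl.symm
    have e2 := hdne (-k) l fun h => hkl' (by rw [h, neg_neg])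
    have e3 := hdne l' l hc.1.symm
    have e4 := hdne (-l') l fun h => hc.2 (by rw [h, neg_neg])
    have := hd0 (-l) l
    have := hd0 k' l
    have := hd0 (-k') l
    have := hd1 l
    simp only [f] at h1
    omega

theorem card_filter_modeEnergy_sub_eq_le [NeZero L] (hL : L.Prime) {k l : ZMod L}
    (hkl : k ≠ l) (hkl' : k ≠ -l) (s : Finset (ZMod L × ZMod L)) :
    (s.filter fun q => modeEnergy q.1 - modeEnergy q.2 = modeEnergy k - modeEnergy l).card ≤ 4 := by
  calc _ ≤ (({k, -k} : Finset (ZMod L)) ×ˢ ({l, -l} : Finset (ZMod L))).card := by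
        refine Finset.card_le_card fun q hq => ?_
        have := eq_or_eq_neg_of_modeEnergy_sub_eq hL hkl hkl' (Finset.mem_filter.mp hq).2.symm
        simpa using this
    _ ≤ 2 * 2 := by
        rw [Finset.card_product]
        exact Nat.mul_le_mul Finset.card_le_two Finset.card_le_two

end Characters

/-! ### Second quantization of one-particle operators. -/

section SecondQuantization

variable {L : ℕ}

/-- The annihilation operator as a linear endomorphism. -/
noncomputable def annEnd (x : Fin L) : Module.End ℂ (Fock L) := (annihilation x).toLinearMap

/-- The creation operator as a linear endomorphism. -/
noncomputable def creEnd (x : Fin L) : Module.End ℂ (Fock L) := (creation x).toLinearMap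

theorem annEnd_mul_creEnd (x y : Fin L) :
    annEnd x * creEnd y = (if x = y then 1 else 0) - creEnd y * annEnd x := by
  refine LinearMap.ext fun ψ => ?_
  have h := DFunLike.congr_fun (annihilation_mul_creation x y) ψ
  split_ifs at h ⊢ <;> exact h

theorem annEnd_mul_annEnd (x y : Fin L) : annEnd x * annEnd y = -(annEnd y * annEnd x) :=
  LinearMap.ext fun ψ => DFunLike.congr_fun (annihilation_mul_annihilation x y) ψ

theorem creEnd_mul_creEnd (x y : Fin L) : creEnd x * creEnd y = -(creEnd y * creEnd x) :=
  LinearMap.ext fun ψ => DFunLike.congr_fun (creation_mul_creation x y) ψ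

theorem inner_creEnd_left (x : Fin L) (φ ψ : Fock L) :
    inner ℂ (creEnd x φ) ψ = inner ℂ φ (annEnd x ψ) := by
  rw [creEnd, annEnd, ContinuousLinearMap.coe_coe, ContinuousLinearMap.coe_coe, creation,
    ContinuousLinearMap.adjoint_inner_left]

/-- After moving creators to the left, the quartic terms cancel: they differ by two exchanges, each
giving a sign. Only the quadratic contraction terms remain. -/
theorem creEnd_mul_annEnd_commutator (x y z w : Fin L) :
    creEnd x * annEnd y * (creEnd z * annEnd w) -
      creEnd z * annEnd w * (creEnd x * annEnd y) =
      (if y = z then creEnd x * annEnd w else 0) -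
        if w = x then creEnd z * annEnd y else 0 := by
  calc _ = creEnd x * (annEnd y * creEnd z) * annEnd w -
        creEnd z * (annEnd w * creEnd x) * annEnd y := by
        simp only [mul_assoc]
    _ = creEnd x * (if y = z then 1 else 0) * annEnd w -
        creEnd z * (if w = x then 1 else 0) * annEnd y -
        (creEnd x * creEnd z) * (annEnd y * annEnd w) +
        (creEnd z * creEnd x) * (annEnd w * annEnd y) := by
        rw [annEnd_mul_creEnd, annEnd_mul_creEnd]
        simp only [mul_sub, sub_mul, mul_assoc]
        abel
    _ = creEnd x * (if y = z then 1 else 0) * annEnd w -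
        creEnd z * (if w = x then 1 else 0) * annEnd y := by
        rw [creEnd_mul_creEnd z x, annEnd_mul_annEnd w y, neg_mul_neg,
          sub_add_cancel]
    _ = _ := by split_ifs <;> simp

/-- The second quantization `∑ A x y c†_x c_y` of a one-particle operator. -/
noncomputable def secondQuant : Matrix (Fin L) (Fin L) ℂ →ₗ[ℂ] Module.End ℂ (Fock L) where
  toFun A := ∑ p : Fin L × Fin L, A p.1 p.2 • (creEnd p.1 * annEnd p.2)
  map_add' A B := by
    simp only [Matrix.add_apply, add_smul, Finset.sum_add_distrib]
  map_smul' a A := by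
    simp only [Matrix.smul_apply, smul_eq_mul, mul_smul, Finset.smul_sum, RingHom.id_apply]

theorem secondQuant_def (A : Matrix (Fin L) (Fin L) ℂ) :
    secondQuant A = ∑ p : Fin L × Fin L, A p.1 p.2 • (creEnd p.1 * annEnd p.2) := rfl

/-- This reduces commutators of many-body operators to those of L × L matrices. -/
theorem secondQuant_commutator (A B : Matrix (Fin L) (Fin L) ℂ) :
    secondQuant A * secondQuant B - secondQuant B * secondQuant A =
      secondQuant (A * B - B * A) := by
  have hprod : ∀ A B : Matrix (Fin L) (Fin L) ℂ, ∑ p : Fin L × Fin L, ∑ q : Fin L × Fin L,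
      (A p.1 p.2 * B q.1 q.2) •
        (if p.2 = q.1 then creEnd p.1 * annEnd q.2 else 0) = secondQuant (A * B) := by
    intro A B
    rw [secondQuant_def]
    simp only [Fintype.sum_prod_type, smul_ite, smul_zero, Matrix.mul_apply, Finset.sum_smul]
    refine Finset.sum_congr rfl fun x _ => ?_
    simp only [Finset.sum_ite_irrel, Finset.sum_const_zero, Finset.sum_ite_eq, Finset.mem_univ,
      if_true]
    exact Finset.sum_comm
  rw [map_sub, ← hprod A B, ← hprod B A]
  rw [Finset.sum_comm (f := fun p q : Fin L × Fin L =>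
    (B p.1 p.2 * A q.1 q.2) • (if p.2 = q.1 then creEnd p.1 * annEnd q.2 else 0))]
  simp only [secondQuant_def, Finset.sum_mul_sum]
  rw [Finset.sum_comm (f := fun p q : Fin L × Fin L =>
    B p.1 p.2 • (creEnd p.1 * annEnd p.2) * A q.1 q.2 • (creEnd q.1 * annEnd q.2))]
  simp only [← Finset.sum_sub_distrib]
  refine Finset.sum_congr rfl fun p _ => Finset.sum_congr rfl fun q _ => ?_
  rw [smul_mul_smul_comm, smul_mul_smul_comm, mul_comm (B _ _), ← smul_sub,
    creEnd_mul_annEnd_commutator, smul_sub]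

theorem secondQuant_mem_sector {N : ℕ} (A : Matrix (Fin L) (Fin L) ℂ) {ψ : Fock L}
    (hψ : ψ ∈ sector L N) : secondQuant A ψ ∈ sector L N := by
  rw [secondQuant_def, LinearMap.sum_apply]
  exact Submodule.sum_mem _ fun p _ => Submodule.smul_mem _ _ (hop_mem_sector p.1 p.2 hψ)

/-- The restriction of `secondQuant A` to the `N`-particle sector. -/
noncomputable def sectorQuant (N : ℕ) (A : Matrix (Fin L) (Fin L) ℂ) : Space L N →L[ℂ] Space L N :=
  LinearMap.toContinuousLinearMap
    ((secondQuant A).restrict fun _ hψ => secondQuant_mem_sector A hψ)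

theorem sectorQuant_coe {N : ℕ} (A : Matrix (Fin L) (Fin L) ℂ) (ψ : Space L N) :
    (sectorQuant N A ψ : Fock L) = secondQuant A ψ := rfl

theorem hop_coe_eq_end {N : ℕ} (x y : Fin L) (ψ : Space L N) :
    (hop N x y ψ : Fock L) = (creEnd x * annEnd y) (ψ : Fock L) := rfl

theorem numberIn_coe {N : ℕ} (Γ : Finset (Fin L)) (ψ : Space L N) :
    (numberIn N Γ ψ : Fock L) =
      secondQuant (Matrix.diagonal fun x => if x ∈ Γ then 1 else 0) ψ := by
  rw [numberIn, sum_apply, Submodule.coe_sum, secondQuant_def]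
  simp only [hop_coe_eq_end, Fintype.sum_prod_type, Matrix.diagonal_apply, ite_smul, one_smul,
    zero_smul, Finset.sum_ite_eq, Finset.mem_univ, if_true, Finset.sum_ite_mem, Finset.univ_inter,
    LinearMap.sum_apply]

theorem secondQuant_one_apply {N : ℕ} (ψ : Space L N) :
    secondQuant (1 : Matrix (Fin L) (Fin L) ℂ) (ψ : Fock L) = (N : ℂ) • (ψ : Fock L) := by
  rw [← numberIn_univ_coe, numberIn_coe]
  simp

/-- The one-particle Hamiltonian: minus the adjacency matrix of the periodic lattice. -/
noncomputable def hoppingMatrix (L : ℕ) : Matrix (Fin L) (Fin L) ℂ :=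
  -Matrix.of fun x y => if latticeDist x y = 1 then 1 else 0

theorem hamiltonian_coe_eq_secondQuant {N : ℕ} (ψ : Space L N) :
    (hamiltonian L N ψ : Fock L) = secondQuant (hoppingMatrix L) ψ := by
  rw [hamiltonian_coe, hoppingMatrix, map_neg, secondQuant_def, Fintype.sum_prod_type,
    LinearMap.neg_apply]
  simp only [hop_coe_eq_end, Matrix.of_apply, ite_smul, one_smul, zero_smul, LinearMap.sum_apply]
  congr 1
  refine Finset.sum_congr rfl fun x _ => Finset.sum_congr rfl fun y _ => ?_
  split_ifs <;> rfl

theorem re_natCast_mul (n : ℕ) (z : ℂ) : ((n : ℂ) * z).re = n * z.re := by simp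

theorem re_inner_self (φ : Fock L) : (inner ℂ φ φ).re = ‖φ‖ ^ 2 :=
  inner_self_eq_norm_sq (𝕜 := ℂ) φ

end SecondQuantization

/-! ### Plane waves, and the Fourier expansion of the number operator. -/

section Modes

variable {L : ℕ} [NeZero L]

open ZMod in
/-- The plane wave with momentum `k`, normalized to have modulus one at every site. -/
noncomputable def planeWave (k : ZMod L) (x : Fin L) : ℂ := stdAddChar (k * finEquiv L x)

theorem star_planeWave (k : ZMod L) (x : Fin L) : star (planeWave k x) = planeWave (-k) x := by
  rw [planeWave, planeWave, neg_mul, AddChar.map_neg_eq_conj]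
  rfl

theorem sum_planeWave_mul (x y : Fin L) :
    ∑ k, planeWave k x * planeWave (-k) y = if x = y then (L : ℂ) else 0 := by
  have h := AddChar.sum_mulShift (ZMod.finEquiv L x - ZMod.finEquiv L y)
    (ZMod.isPrimitive_stdAddChar L)
  simp only [sub_eq_zero, (ZMod.finEquiv L).injective.eq_iff, ZMod.card, Nat.cast_ite,
    Nat.cast_zero] at h
  rw [← h]
  refine Finset.sum_congr rfl fun k _ => ?_
  rw [planeWave, planeWave, ← AddChar.map_add_eq_mul]
  congr 1
  ring

theorem latticeDist_eq_one_iff (hL : 2 < L) (x y : Fin L) :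
    latticeDist x y = 1 ↔ y = x + 1 ∨ y = x - 1 := by
  have hval (a : Fin L) : a.val = 1 ↔ a = 1 := by
    rw [Fin.ext_iff, Fin.val_one', Nat.mod_eq_of_lt (by omega)]
  have hy1 : y = x + 1 ↔ (y - x : Fin L).val = 1 := by
    rw [hval, sub_eq_iff_eq_add, add_comm]
  have hy2 : y = x - 1 ↔ (x - y : Fin L).val = 1 := by
    rw [hval, sub_eq_iff_eq_add, eq_sub_iff_add_eq, add_comm, eq_comm]
  rw [hy1, hy2, latticeDist]
  have hpos : x ≠ y → 0 < (x - y : Fin L).val ∧ 0 < (y - x : Fin L).val := by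
    intro h
    exact ⟨Fin.pos_iff_ne_zero.mpr (sub_ne_zero.mpr h),
      Fin.pos_iff_ne_zero.mpr (sub_ne_zero.mpr h.symm)⟩
  by_cases h : x = y
  · subst h; simp
  · have := hpos h
    omega

theorem sum_latticeDist_planeWave (hL : 2 < L) (k : ZMod L) (x : Fin L) :
    ∑ y, (if latticeDist x y = 1 then (1 : ℂ) else 0) * planeWave k y =
      -modeEnergy k * planeWave k x := by
  -- For L = 2 the two neighbours would coincide and the eigenvalue would be halved.
  have hne : x + 1 ≠ x - 1 := by
    intro h
    have h2 : (2 : ZMod L) = 0 := by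
      have := congrArg (ZMod.finEquiv L) h
      rw [map_add, map_sub, map_one] at this
      linear_combination this
    have h3 : L ∣ 2 := (ZMod.natCast_eq_zero_iff 2 L).mp (by exact_mod_cast h2)
    exact absurd (Nat.le_of_dvd (by norm_num) h3) (by omega)
  have h1 : Finset.univ.filter (fun y => latticeDist x y = 1) = {x + 1, x - 1} := by
    ext y; simp [latticeDist_eq_one_iff hL]
  simp only [ite_mul, one_mul, zero_mul]
  rw [← Finset.sum_filter, h1, Finset.sum_pair hne, modeEnergy_coe, neg_neg, planeWave, planeWave,
    planeWave, add_mul, ← AddChar.map_add_eq_mul, ← AddChar.map_add_eq_mul, map_add, map_sub,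
    map_one]
  congr 2 <;> ring

theorem modeEnergy_neg (k : ZMod L) : modeEnergy (-k) = modeEnergy k := by
  rw [modeEnergy, AddChar.map_neg_eq_conj, Complex.conj_re, modeEnergy]

/-- The one-particle operator that moves a particle from the mode `l` to the mode `k`. -/
noncomputable def modeMatrix (k l : ZMod L) : Matrix (Fin L) (Fin L) ℂ :=
  Matrix.vecMulVec (planeWave k) (planeWave (-l))

/-- The mode matrix has rank one and is built from eigenvectors of the symmetric hopping matrix; the
energy is even in the momentum, so the factor with momentum -l contributes the energy of l. -/
theorem hoppingMatrix_commutator_modeMatrix (hL : 2 < L) (k l : ZMod L) :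
    hoppingMatrix L * modeMatrix k l - modeMatrix k l * hoppingMatrix L =
      ((modeEnergy k - modeEnergy l : ℝ) : ℂ) • modeMatrix k l := by
  have h1 : ∀ k : ZMod L,
      (hoppingMatrix L).mulVec (planeWave k) = (modeEnergy k : ℂ) • planeWave k := by
    intro k
    ext x
    rw [hoppingMatrix, Matrix.neg_mulVec, Pi.neg_apply, Pi.smul_apply, smul_eq_mul, Matrix.mulVec,
      dotProduct]
    simp only [Matrix.of_apply]
    rw [sum_latticeDist_planeWave hL, neg_mul, neg_neg]
  have h2 : (hoppingMatrix L).transpose = hoppingMatrix L := by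
    ext x y
    simp [hoppingMatrix, latticeDist_comm x y]
  rw [modeMatrix, Matrix.mul_vecMulVec, Matrix.vecMulVec_mul, h1, ← Matrix.mulVec_transpose, h2,
    h1, modeEnergy_neg]
  ext x y
  simp [Matrix.vecMulVec_apply]
  ring

theorem hamiltonian_sectorQuant_modeMatrix (hL : 2 < L) {N : ℕ} (c : ℂ) (k l : ZMod L)
    (ψ : Space L N) :
    hamiltonian L N (sectorQuant N (c • modeMatrix k l) ψ) =
      sectorQuant N (c • modeMatrix k l) (hamiltonian L N ψ) +
        ((modeEnergy k - modeEnergy l : ℝ) : ℂ) • sectorQuant N (c • modeMatrix k l) ψ := by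
  apply Subtype.ext
  have h := secondQuant_commutator (hoppingMatrix L) (c • modeMatrix k l)
  rw [Matrix.mul_smul, Matrix.smul_mul, ← smul_sub, hoppingMatrix_commutator_modeMatrix hL,
    smul_comm, map_smul secondQuant ((modeEnergy k - modeEnergy l : ℝ) : ℂ),
    sub_eq_iff_eq_add'] at h
  have h' := congrArg (fun A : Module.End ℂ (Fock L) => A ψ) h
  rw [Submodule.coe_add, hamiltonian_coe_eq_secondQuant, sectorQuant_coe, sectorQuant_coe,
    hamiltonian_coe_eq_secondQuant]
  exact h'

theorem sum_modeMatrix_self : ∑ k : ZMod L, modeMatrix k k = (L : ℂ) • 1 := by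
  ext x y
  simp [modeMatrix, Matrix.sum_apply, Matrix.vecMulVec_apply, sum_planeWave_mul, Matrix.one_apply]

/-- The Fourier coefficients of the indicator function of `Γ`. -/
noncomputable def fourierCoeffOf (Γ : Finset (Fin L)) (q : ZMod L) : ℂ := ∑ x ∈ Γ, planeWave q x

theorem planeWave_add (k l : ZMod L) (x : Fin L) :
    planeWave (k + l) x = planeWave k x * planeWave l x := by
  rw [planeWave, add_mul, AddChar.map_add_eq_mul]; rfl

theorem sum_norm_sq_fourierCoeffOf (Γ : Finset (Fin L)) :
    ∑ q, ‖fourierCoeffOf Γ q‖ ^ 2 = L * Γ.card := by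
  have h : ∑ q, fourierCoeffOf Γ q * star (fourierCoeffOf Γ q) = (L : ℂ) * Γ.card := by
    simp only [fourierCoeffOf, star_sum, star_planeWave, Finset.sum_mul_sum]
    rw [Finset.sum_comm]
    calc _ = ∑ x ∈ Γ, ∑ y ∈ Γ, ∑ q, planeWave q x * planeWave (-q) y :=
          Finset.sum_congr rfl fun x _ => Finset.sum_comm
      _ = ∑ x ∈ Γ, (L : ℂ) := by
          refine Finset.sum_congr rfl fun x hx => ?_
          simp only [sum_planeWave_mul]
          rw [Finset.sum_ite_eq, if_pos hx]
      _ = _ := by simp [mul_comm]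
  have h' : ((∑ q, ‖fourierCoeffOf Γ q‖ ^ 2 : ℝ) : ℂ) = ((L * Γ.card : ℝ) : ℂ) := by
    push_cast
    rw [← h]
    exact Finset.sum_congr rfl fun q _ => (Complex.mul_conj' _).symm
  exact_mod_cast h'

theorem sum_norm_sq_fourierCoeffOf_le (Γ : Finset (Fin L)) :
    ∑ q, ‖fourierCoeffOf Γ q‖ ^ 2 ≤ (L : ℝ) ^ 2 := by
  rw [sum_norm_sq_fourierCoeffOf, sq]
  gcongr
  simpa using Γ.card_le_univ

/-- Expanding the coefficient over z ∈ Γ factorizes the double sum into two completeness relations.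
Each gives a factor L, as the plane waves are unnormalized. -/
theorem sum_fourierCoeffOf_smul_modeMatrix (Γ : Finset (Fin L)) :
    ∑ p : ZMod L × ZMod L, fourierCoeffOf Γ (p.2 - p.1) • modeMatrix p.1 p.2 =
      ((L : ℂ) ^ 2) • Matrix.diagonal fun x => if x ∈ Γ then (1 : ℂ) else 0 := by
  ext x y
  simp only [modeMatrix, Matrix.sum_apply, Matrix.smul_apply, Matrix.vecMulVec_apply, smul_eq_mul,
    fourierCoeffOf, Finset.sum_mul]
  rw [Finset.sum_comm]
  calc _ = ∑ z ∈ Γ, (∑ k, planeWave k x * planeWave (-k) z) *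
        (∑ l, planeWave l z * planeWave (-l) y) := by
        refine Finset.sum_congr rfl fun z _ => ?_
        rw [Finset.sum_mul_sum, Fintype.sum_prod_type]
        refine Finset.sum_congr rfl fun k _ => Finset.sum_congr rfl fun l _ => ?_
        simp only [sub_eq_add_neg, planeWave_add]
        ring
    _ = _ := by
        simp only [sum_planeWave_mul, Matrix.diagonal_apply]
        by_cases hxy : x = y
        · subst hxy
          simp [sq]
        · simp only [hxy, if_false, mul_zero]
          refine Finset.sum_eq_zero fun z _ => ?_
          by_cases hxz : x = z
          · subst hxz; simp [hxy]
          · simp [hxz]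

/-- The diagonal terms all have coefficient |Γ| and sum to |Γ|L = L²μ times the identity, so
removing them centres the indicator at its mean. -/
theorem sum_offDiag_fourierCoeffOf_smul_modeMatrix (Γ : Finset (Fin L)) :
    ∑ p : ZMod L × ZMod L with p.1 ≠ p.2, fourierCoeffOf Γ (p.2 - p.1) • modeMatrix p.1 p.2 =
      ((L : ℂ) ^ 2) • ((Matrix.diagonal fun x => if x ∈ Γ then (1 : ℂ) else 0) -
        (relSize Γ : ℂ) • 1) := by
  have hdiag : ∑ p : ZMod L × ZMod L with p.1 = p.2,
      fourierCoeffOf Γ (p.2 - p.1) • modeMatrix p.1 p.2 = ((Γ.card : ℂ) * L) • 1 := by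
    rw [mul_smul, ← sum_modeMatrix_self, Finset.smul_sum, Finset.sum_filter, Fintype.sum_prod_type]
    refine Finset.sum_congr rfl fun k _ => ?_
    rw [Finset.sum_ite_eq, if_pos (Finset.mem_univ k), sub_self]
    congr 1
    simp [fourierCoeffOf, planeWave]
  have h := sum_fourierCoeffOf_smul_modeMatrix Γ
  rw [← Finset.sum_filter_add_sum_filter_not _ (fun p : ZMod L × ZMod L => p.1 = p.2), hdiag] at h
  have hc : (L : ℂ) ^ 2 * (relSize Γ : ℂ) = Γ.card * L := by
    have hL : (L : ℂ) ≠ 0 := NeZero.ne _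
    rw [relSize]
    push_cast
    field_simp
  rw [smul_sub, ← h, smul_smul, hc, add_sub_cancel_left]

theorem sum_offDiag_sectorQuant_coe {N : ℕ} (Γ : Finset (Fin L)) (ψ : Space L N) :
    ((∑ p : ZMod L × ZMod L with p.1 ≠ p.2,
      sectorQuant N (fourierCoeffOf Γ (p.2 - p.1) • modeMatrix p.1 p.2) ψ : Space L N) : Fock L) =
      ((L : ℂ) ^ 2) •
        ((numberIn N Γ ψ : Fock L) - ((N * relSize Γ : ℝ) : ℂ) • (ψ : Fock L)) := by
  rw [Submodule.coe_sum]
  simp only [sectorQuant_coe]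
  rw [← LinearMap.sum_apply, ← map_sum, sum_offDiag_fourierCoeffOf_smul_modeMatrix, map_smul,
    map_sub, map_smul, LinearMap.smul_apply, LinearMap.sub_apply, LinearMap.smul_apply,
    secondQuant_one_apply, numberIn_coe, smul_smul]
  congr 3
  push_cast
  ring

/-- The annihilation operator `b_k = ∑_x e^{-2πikx/L} c_x` of the mode `k`. -/
noncomputable def modeAnn (k : ZMod L) : Module.End ℂ (Fock L) :=
  ∑ x, planeWave (-k) x • annEnd x

/-- The creation operator `b†_k = ∑_x e^{2πikx/L} c†_x` of the mode `k`. -/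
noncomputable def modeCre (k : ZMod L) : Module.End ℂ (Fock L) :=
  ∑ x, planeWave k x • creEnd x

theorem inner_modeCre_left (k : ZMod L) (φ ψ : Fock L) :
    inner ℂ (modeCre k φ) ψ = inner ℂ φ (modeAnn k ψ) := by
  simp only [modeCre, modeAnn, LinearMap.sum_apply, LinearMap.smul_apply, sum_inner, inner_sum,
    inner_smul_left, inner_smul_right, inner_creEnd_left]
  refine Finset.sum_congr rfl fun x _ => ?_
  rw [← star_planeWave]
  rfl

theorem inner_modeCre_right (k : ZMod L) (φ ψ : Fock L) :
    inner ℂ φ (modeCre k ψ) = inner ℂ (modeAnn k φ) ψ := by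
  rw [← inner_conj_symm, inner_modeCre_left, inner_conj_symm]

theorem secondQuant_modeMatrix (k l : ZMod L) :
    secondQuant (modeMatrix k l) = modeCre k * modeAnn l := by
  rw [modeCre, modeAnn, modeMatrix, secondQuant_def, Finset.sum_mul_sum, Fintype.sum_prod_type]
  simp only [smul_mul_smul_comm, Matrix.vecMulVec_apply]

theorem modeAnn_mul_modeCre (k : ZMod L) :
    modeAnn k * modeCre k = (L : ℂ) • 1 - modeCre k * modeAnn k := by
  have hone (x : Fin L) : planeWave k x * planeWave (-k) x = 1 := by
    rw [← planeWave_add, add_neg_cancel]; simp [planeWave]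
  rw [modeCre, modeAnn, Finset.sum_mul_sum, Finset.sum_mul_sum,
    Finset.sum_comm (f := fun x y => (planeWave k x • creEnd x) *
      (planeWave (-k) y • annEnd y)), eq_sub_iff_add_eq, ← Finset.sum_add_distrib]
  calc _ = ∑ x : Fin L, (1 : Module.End ℂ (Fock L)) := by
        refine Finset.sum_congr rfl fun x _ => ?_
        rw [← Finset.sum_add_distrib]
        calc _ = ∑ y, (planeWave k y * planeWave (-k) x) •
              (if x = y then (1 : Module.End ℂ (Fock L)) else 0) := by
              refine Finset.sum_congr rfl fun y _ => ?_
              rw [smul_mul_smul_comm, smul_mul_smul_comm, annEnd_mul_creEnd,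
                mul_comm (planeWave (-k) x), ← smul_add, sub_add_cancel]
          _ = _ := by
              simp only [smul_ite, smul_zero, Finset.sum_ite_eq, Finset.mem_univ, if_true, hone,
                one_smul]
    _ = _ := by
        rw [Finset.sum_const, Finset.card_univ, Fintype.card_fin, Nat.cast_smul_eq_nsmul]

/-- Pauli principle: b_k b_k† = L - b_k†b_k ≤ L, with no dependence on the particle number. -/
theorem norm_sq_modeCre_le (k : ZMod L) (φ : Fock L) : ‖modeCre k φ‖ ^ 2 ≤ L * ‖φ‖ ^ 2 := by
  have h : inner ℂ (modeCre k φ) (modeCre k φ) =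
      (L : ℂ) * inner ℂ φ φ - inner ℂ (modeAnn k φ) (modeAnn k φ) := by
    have h1 := congrArg (fun A : Module.End ℂ (Fock L) => A φ) (modeAnn_mul_modeCre k)
    simp only [Module.End.mul_apply, LinearMap.sub_apply, LinearMap.smul_apply,
      Module.End.one_apply] at h1
    rw [inner_modeCre_left, h1, inner_sub_right, inner_smul_right, inner_modeCre_right]
  have h' := congrArg Complex.re h
  rw [Complex.sub_re, re_natCast_mul, re_inner_self, re_inner_self, re_inner_self] at h'
  rw [h']
  linarith [sq_nonneg ‖modeAnn k φ‖]

theorem norm_sq_sectorQuant_modeMatrix_le {N : ℕ} (c : ℂ) (k l : ZMod L) (ψ : Space L N) :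
    ‖sectorQuant N (c • modeMatrix k l) ψ‖ ^ 2 ≤ ‖c‖ ^ 2 * (L * ‖modeAnn l (ψ : Fock L)‖ ^ 2) := by
  change ‖(sectorQuant N (c • modeMatrix k l) ψ : Fock L)‖ ^ 2 ≤ _
  rw [sectorQuant_coe, map_smul, LinearMap.smul_apply, secondQuant_modeMatrix, norm_smul, mul_pow]
  gcongr
  exact norm_sq_modeCre_le k _

/-- The sum of b_k†b_k is L times the total particle number. This is the source of the single factor
N in the variance bound. -/
theorem sum_norm_sq_modeAnn {N : ℕ} (ψ : Space L N) :
    ∑ k, ‖modeAnn k (ψ : Fock L)‖ ^ 2 = L * N * ‖ψ‖ ^ 2 := by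
  have h1 : ∑ k : ZMod L, modeCre k * modeAnn k = (L : ℂ) • secondQuant 1 := by
    simp only [← secondQuant_modeMatrix]
    rw [← map_sum, sum_modeMatrix_self, map_smul]
  have h := congrArg (fun A : Module.End ℂ (Fock L) => (inner ℂ (ψ : Fock L) (A ψ)).re) h1
  simp only [LinearMap.sum_apply, inner_sum, LinearMap.smul_apply, inner_smul_right,
    Module.End.mul_apply, inner_modeCre_right, secondQuant_one_apply, Complex.re_sum,
    re_natCast_mul, re_inner_self] at h
  rw [h, mul_assoc]
  rfl

end Modes

/-! ### Unitary evolution and energy shifts. -/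

section Evolution

variable {E : Type*} [NormedAddCommGroup E] [InnerProductSpace ℂ E] [FiniteDimensional ℂ E]

theorem norm_evolve {H : E →L[ℂ] E} (hH : ∀ φ ψ, inner ℂ (H φ) ψ = inner ℂ φ (H ψ)) (t : ℝ)
    (ψ : E) : ‖evolve H t ψ‖ = ‖ψ‖ := by
  have : CompleteSpace E := FiniteDimensional.complete ℂ E
  let : NormedAlgebra ℚ (E →L[ℂ] E) := .restrictScalars ℚ ℂ _
  have hs : star H = H := by
    rw [ContinuousLinearMap.star_eq_adjoint]
    exact ((ContinuousLinearMap.eq_adjoint_iff _ _).mpr hH).symm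
  have hm : (-(Complex.I * (t : ℂ))) • H ∈ skewAdjoint (E →L[ℂ] E) := by
    rw [skewAdjoint.mem_iff, star_smul, hs, ← neg_smul]
    congr 1
    simp
  have hu := NormedSpace.exp_mem_unitary_of_mem_skewAdjoint hm
  exact ContinuousLinearMap.norm_map_of_mem_unitary hu ψ

theorem continuous_evolve (H : E →L[ℂ] E) (ψ : E) : Continuous fun t : ℝ => evolve H t ψ := by
  have : CompleteSpace E := FiniteDimensional.complete ℂ E
  let : NormedAlgebra ℚ (E →L[ℂ] E) := .restrictScalars ℚ ℂ _
  unfold evolve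
  have h : Continuous fun t : ℝ => NormedSpace.exp ((-(Complex.I * (t : ℂ))) • H) :=
    NormedSpace.exp_continuous.comp (by fun_prop)
  exact h.clm_apply continuous_const

/-- An operator that shifts the energy by `ω` picks up the phase `e^{iωt}` in the Heisenberg
picture. -/
theorem apply_evolve_of_shift {H O : E →L[ℂ] E} {ω : ℝ} (h : H * O = O * H + (ω : ℂ) • O) (t : ℝ)
    (ψ : E) :
    O (evolve H t ψ) = evolve H t (Complex.exp (Complex.I * ω * t) • O ψ) := by
  have : CompleteSpace E := FiniteDimensional.complete ℂ E
  let : NormedAlgebra ℚ (E →L[ℂ] E) := .restrictScalars ℚ ℂ _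
  set z : ℂ := -(Complex.I * t) with hz
  -- Moving `O` past zH shifts it by the scalar -zω, which is central and splits off from the
  -- exponential as the phase e^{iωt}.
  have hsc : SemiconjBy O (z • H) (z • H + algebraMap ℂ (E →L[ℂ] E) (-(z * ω))) := by
    rw [SemiconjBy, add_mul, smul_mul_assoc, h, Algebra.algebraMap_eq_smul_one, smul_mul_assoc,
      one_mul, smul_add, smul_smul, mul_smul_comm, neg_smul (z * (ω : ℂ)), add_neg_cancel_right]
  have he := hsc.exp_right
  rw [NormedSpace.exp_add_of_commute (Algebra.commutes' _ _).symm,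
    ← NormedSpace.algebraMap_exp_comm, ← Complex.exp_eq_exp_ℂ] at he
  have := congrArg (fun A : E →L[ℂ] E => A ψ) he.eq
  simp only [mul_apply_eq_comp, Algebra.algebraMap_eq_smul_one, smul_apply,
    one_apply_eq_self] at this
  rw [evolve, evolve, ← hz, this]
  congr 3
  rw [hz]
  ring

end Evolution

/-! ### Time averages of almost periodic functions. -/

theorem tendsto_average_exp (ω : ℝ) :
    Tendsto (fun T : ℝ => (1 / T : ℂ) * ∫ t in (0 : ℝ)..T, Complex.exp (Complex.I * ω * t)) atTop
      (nhds (if ω = 0 then 1 else 0)) := by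
  split_ifs with h
  · refine tendsto_const_nhds.congr' ?_
    filter_upwards [eventually_ne_atTop 0] with T hT
    simp [h, hT]
  · have hc : Complex.I * ω ≠ 0 := by simp [h]
    rw [tendsto_zero_iff_norm_tendsto_zero]
    have hb : Tendsto (fun T : ℝ => T⁻¹ * (2 / ‖Complex.I * ω‖)) atTop (nhds 0) := by
      simpa using tendsto_inv_atTop_zero.mul_const (2 / ‖Complex.I * (ω : ℂ)‖)
    refine squeeze_zero' (Eventually.of_forall fun _ => norm_nonneg _) ?_ hb
    filter_upwards [eventually_gt_atTop 0] with T hT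
    rw [integral_exp_mul_complex hc, norm_mul, norm_div, norm_div]
    have h1 : ‖Complex.exp (Complex.I * ω * T) - Complex.exp (Complex.I * ω * (0 : ℝ))‖ ≤ 2 := by
      refine (norm_sub_le _ _).trans ?_
      have : Complex.I * (ω : ℂ) * T = ((ω * T : ℝ) : ℂ) * Complex.I := by push_cast; ring
      rw [this, Complex.norm_exp_ofReal_mul_I]
      simp
      norm_num
    have h2 : ‖(T : ℂ)‖ = T := by simp [abs_of_pos hT]
    rw [h2, norm_one, one_div]
    gcongr

/-- If each frequency occurs at most `m` times, the time average of the squared norm of an almost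
periodic function is at most `m` times the sum of the squared norms of its coefficients. -/
theorem exists_tendsto_average_norm_sq {ι F : Type*} [NormedAddCommGroup F]
    [InnerProductSpace ℂ F] (s : Finset ι) (ω : ι → ℝ) (v : ι → F) (m : ℕ)
    (hm : ∀ p ∈ s, (s.filter fun q => ω q = ω p).card ≤ m) :
    ∃ a ≤ m * ∑ p ∈ s, ‖v p‖ ^ 2, Tendsto (fun T : ℝ => (1 / T) * ∫ t in (0 : ℝ)..T,
      ‖∑ p ∈ s, Complex.exp (Complex.I * ω p * t) • v p‖ ^ 2) atTop (nhds a) := by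
  -- Only pairs of equal frequency survive averaging. As that relation is symmetric, 2ab ≤ a² + b²
  -- replaces each pair by one squared norm, counted at most `m` times.
  refine ⟨∑ p ∈ s, ∑ q ∈ s.filter (fun q => ω q = ω p), (inner ℂ (v p) (v q)).re, ?_, ?_⟩
  · have h1 : ∀ p q, (inner ℂ (v p) (v q)).re ≤ (‖v p‖ ^ 2 + ‖v q‖ ^ 2) / 2 := by
      intro p q
      have := (Complex.re_le_norm _).trans (norm_inner_le_norm (𝕜 := ℂ) (v p) (v q))
      nlinarith [sq_nonneg (‖v p‖ - ‖v q‖)]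
    have h2 : ∑ p ∈ s, ∑ q ∈ s.filter (fun q => ω q = ω p), ‖v q‖ ^ 2 =
        ∑ p ∈ s, ∑ q ∈ s.filter (fun q => ω q = ω p), ‖v p‖ ^ 2 := by
      simp_rw [Finset.sum_filter]
      rw [Finset.sum_comm]
      simp_rw [eq_comm]
    calc _ ≤ ∑ p ∈ s, ∑ q ∈ s.filter (fun q => ω q = ω p), (‖v p‖ ^ 2 + ‖v q‖ ^ 2) / 2 :=
          Finset.sum_le_sum fun p _ => Finset.sum_le_sum fun q _ => h1 p q
      _ = ∑ p ∈ s, ∑ q ∈ s.filter (fun q => ω q = ω p), ‖v p‖ ^ 2 := by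
          simp_rw [← Finset.sum_div, Finset.sum_add_distrib]
          rw [h2]; ring
      _ ≤ ∑ p ∈ s, m * ‖v p‖ ^ 2 := by
          refine Finset.sum_le_sum fun p hp => ?_
          rw [Finset.sum_const, nsmul_eq_mul]
          gcongr
          exact hm p hp
      _ = _ := by rw [Finset.mul_sum]
  · have hexp : ∀ t : ℝ, ‖∑ p ∈ s, Complex.exp (Complex.I * ω p * t) • v p‖ ^ 2 =
        (∑ p ∈ s, ∑ q ∈ s, Complex.exp (Complex.I * ((ω q - ω p : ℝ) : ℂ) * t) *
          inner ℂ (v p) (v q)).re := by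
      intro t
      rw [← inner_self_eq_norm_sq (𝕜 := ℂ), sum_inner]
      simp_rw [inner_sum, inner_smul_left, inner_smul_right]
      change Complex.re _ = _
      congr 1
      refine Finset.sum_congr rfl fun p _ => Finset.sum_congr rfl fun q _ => ?_
      rw [← mul_assoc, ← Complex.exp_conj, ← Complex.exp_add]
      congr 2
      simp
      ring
    have hint : ∀ T : ℝ, (1 / T) * ∫ t in (0 : ℝ)..T,
        ‖∑ p ∈ s, Complex.exp (Complex.I * ω p * t) • v p‖ ^ 2 =
        (∑ p ∈ s, ∑ q ∈ s, ((1 / T : ℂ) * ∫ t in (0 : ℝ)..T,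
          Complex.exp (Complex.I * ((ω q - ω p : ℝ) : ℂ) * t)) * inner ℂ (v p) (v q)).re := by
      intro T
      simp_rw [hexp]
      have hc : ∀ p q, Continuous fun t : ℝ =>
          Complex.exp (Complex.I * ((ω q - ω p : ℝ) : ℂ) * t) * inner ℂ (v p) (v q) := by
        intro p q; fun_prop
      have h1 : ∫ t in (0 : ℝ)..T, (∑ p ∈ s, ∑ q ∈ s,
          Complex.exp (Complex.I * ((ω q - ω p : ℝ) : ℂ) * t) * inner ℂ (v p) (v q)).re =
          (∫ t in (0 : ℝ)..T, ∑ p ∈ s, ∑ q ∈ s,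
          Complex.exp (Complex.I * ((ω q - ω p : ℝ) : ℂ) * t) * inner ℂ (v p) (v q)).re :=
        Complex.reCLM.intervalIntegral_comp_comm (Continuous.intervalIntegrable
          (continuous_finsetSum _ fun p _ => continuous_finsetSum _ fun q _ => hc p q) _ _)
      rw [h1, intervalIntegral.integral_finsetSum fun p _ => Continuous.intervalIntegrable
        (continuous_finsetSum _ fun q _ => hc p q) _ _]
      simp_rw [intervalIntegral.integral_finsetSum fun q (_ : q ∈ s) =>
        (hc _ q).intervalIntegrable 0 T, intervalIntegral.integral_mul_const]
      rw [← Complex.re_ofReal_mul, Finset.mul_sum]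
      congr 1
      refine Finset.sum_congr rfl fun p _ => ?_
      rw [Finset.mul_sum]
      refine Finset.sum_congr rfl fun q _ => ?_
      push_cast
      ring
    simp_rw [hint]
    have hlim : Tendsto (fun T : ℝ => (∑ p ∈ s, ∑ q ∈ s, ((1 / T : ℂ) * ∫ t in (0 : ℝ)..T,
          Complex.exp (Complex.I * ((ω q - ω p : ℝ) : ℂ) * t)) * inner ℂ (v p) (v q))) atTop
        (nhds (∑ p ∈ s, ∑ q ∈ s, (if ω q - ω p = 0 then 1 else 0) * inner ℂ (v p) (v q))) :=
      tendsto_finsetSum _ fun p _ => tendsto_finsetSum _ fun q _ =>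
        (tendsto_average_exp _).mul_const _
    have hval : (∑ p ∈ s, ∑ q ∈ s, (if ω q - ω p = 0 then 1 else 0) * inner ℂ (v p) (v q)).re =
        ∑ p ∈ s, ∑ q ∈ s.filter (fun q => ω q = ω p), (inner ℂ (v p) (v q)).re := by
      rw [Complex.re_sum]
      refine Finset.sum_congr rfl fun p _ => ?_
      rw [Finset.sum_filter, Complex.re_sum]
      refine Finset.sum_congr rfl fun q _ => ?_
      simp only [sub_eq_zero]
      split_ifs <;> simp
    rw [← hval]
    exact (Complex.continuous_re.tendsto _).comp hlim

/-- Markov's inequality for time averages. -/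
theorem forMostTimes_of_average_le {f g : ℝ → ℝ} (hf : Continuous f) (hg : Continuous g)
    (hf0 : ∀ t, 0 ≤ f t) (hfg : ∀ t, f t ≤ g t) {a ε δ : ℝ} (hε : 0 < ε)
    (hlim : Tendsto (fun T : ℝ => (1 / T) * ∫ t in (0 : ℝ)..T, g t) atTop (nhds a))
    (ha : a ≤ ε * δ) : ForMostTimes δ fun t => f t < ε := by
  have hbound : ∀ᶠ T : ℝ in atTop, 1 - (1 / T * ∫ t in (0 : ℝ)..T, g t) / ε ≤
      (1 / T) * (volume {t : ℝ | t ∈ Set.Icc 0 T ∧ f t < ε}).toReal := by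
    filter_upwards [eventually_gt_atTop 0] with T hT
    have hA : MeasurableSet {t : ℝ | f t < ε} := measurableSet_lt hf.measurable measurable_const
    have h1 : (volume {t : ℝ | t ∈ Set.Icc 0 T ∧ f t < ε}).toReal =
        ∫ t in Set.Icc 0 T, ({t : ℝ | f t < ε}.indicator 1 : ℝ → ℝ) t := by
      rw [integral_indicator_one hA, Measure.real, Measure.restrict_apply hA, Set.inter_comm]
      rfl
    -- Pointwise, 1 - g/ε is at most the indicator of f < ε: it is at most 1 everywhere, and at most
    -- 0 where g ≥ f ≥ ε.
    have h2 : ∫ t in Set.Icc 0 T, (1 - g t / ε) ≤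
        ∫ t in Set.Icc 0 T, ({t : ℝ | f t < ε}.indicator 1 : ℝ → ℝ) t := by
      refine integral_mono ?_ ?_ fun t => ?_
      · exact (continuous_const.sub (hg.div_const ε)).integrableOn_Icc
      · exact ((continuous_const (y := (1 : ℝ))).integrableOn_Icc (μ := volume)).indicator hA
      · by_cases h : f t < ε
        · rw [Set.indicator_of_mem (by exact h)]
          have := div_nonneg ((hf0 t).trans (hfg t)) hε.le
          simpa using this
        · rw [Set.indicator_of_notMem (by exact h), sub_nonpos, le_div_iff₀ hε, one_mul]
          exact (not_lt.mp h).trans (hfg t)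
    rw [h1]
    have h3 : ∫ t in Set.Icc 0 T, (1 - g t / ε) = T - (∫ t in (0 : ℝ)..T, g t) / ε := by
      rw [integral_Icc_eq_integral_Ioc, ← intervalIntegral.integral_of_le hT.le,
        intervalIntegral.integral_sub (continuous_const.intervalIntegrable _ _)
          ((hg.div_const ε).intervalIntegrable _ _), intervalIntegral.integral_div]
      simp
    rw [h3] at h2
    calc _ = 1 / T * (T - (∫ t in (0 : ℝ)..T, g t) / ε) := by field_simp
      _ ≤ _ := by gcongr
  have hl : Tendsto (fun T : ℝ => 1 - (1 / T * ∫ t in (0 : ℝ)..T, g t) / ε) atTop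
      (nhds (1 - a / ε)) := tendsto_const_nhds.sub (hlim.div_const ε)
  have h1 : 1 - δ ≤ 1 - a / ε := by
    have : a / ε ≤ δ := by rwa [div_le_iff₀ hε, mul_comm]
    linarith
  refine h1.trans ?_
  rw [← hl.liminf_eq]
  refine liminf_le_liminf hbound hl.isBoundedUnder_ge ?_
  -- The real `liminf` is meaningful only with an upper bound; the fraction of good times is at most
  -- 1.
  refine IsBoundedUnder.isCoboundedUnder_ge (Filter.isBoundedUnder_of_eventually_le (a := 1) ?_)
  filter_upwards [eventually_gt_atTop 0] with T hT
  have : (volume {t : ℝ | t ∈ Set.Icc 0 T ∧ f t < ε}).toReal ≤ T := by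
    calc _ ≤ (volume (Set.Icc 0 T)).toReal :=
          ENNReal.toReal_mono (by simp) (measure_mono fun t ht => ht.1)
      _ = T := by simp [hT.le]
  calc _ ≤ 1 / T * T := by gcongr
    _ = 1 := by field_simp

/-! ### Evolved sums of shift operators, and Chebyshev's inequality. -/

section Evolution

variable {E : Type*} [NormedAddCommGroup E] [InnerProductSpace ℂ E] [FiniteDimensional ℂ E]

theorem norm_sum_apply_evolve {ι : Type*} {H : E →L[ℂ] E}
    (hH : ∀ φ ψ, inner ℂ (H φ) ψ = inner ℂ φ (H ψ)) (s : Finset ι) {O : ι → E →L[ℂ] E} {ω : ι → ℝ}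
    (hO : ∀ p φ, H (O p φ) = O p (H φ) + (ω p : ℂ) • O p φ) (t : ℝ) (ψ : E) :
    ‖∑ p ∈ s, O p (evolve H t ψ)‖ = ‖∑ p ∈ s, Complex.exp (Complex.I * ω p * t) • O p ψ‖ := by
  rw [← norm_evolve hH t (∑ p ∈ s, Complex.exp (Complex.I * ω p * t) • O p ψ)]
  congr 1
  conv_rhs => rw [evolve, map_sum]
  exact Finset.sum_congr rfl fun p _ =>
    apply_evolve_of_shift (ContinuousLinearMap.ext fun φ => hO p φ) t ψ

/-- The projection gives the nearest point of the spectral subspace, so any sum of admissible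
eigenvectors bounds the distance and the projection need not be computed. -/
theorem norm_sub_spectralProjection_le {ι : Type*} (A : E →L[ℂ] E) (s : Set ℝ) (φ : E)
    (t : Finset ι) {ν : ι → ℝ} {v : ι → E} {w : E} (hν : ∀ i ∈ t, ν i ∈ s)
    (hv : ∀ i ∈ t, A (v i) = (ν i : ℂ) • v i) (hw : w = ∑ i ∈ t, v i) :
    ‖φ - spectralProjection A s φ‖ ≤ ‖φ - w‖ := by
  have hmem : w ∈ ⨆ ν ∈ s, Module.End.eigenspace (A : E →ₗ[ℂ] E) (ν : ℂ) :=
    hw ▸ Submodule.sum_mem _ fun i hi => Submodule.mem_iSup_of_mem (ν i)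
      (Submodule.mem_iSup_of_mem (hν i hi) (Module.End.mem_eigenspace_iff.mpr (hv i hi)))
  rw [spectralProjection, Submodule.starProjection_minimal]
  exact ciInf_le ⟨0, by rintro _ ⟨x, rfl⟩; exact norm_nonneg _⟩
    (⟨w, hmem⟩ : (⨆ ν ∈ s, Module.End.eigenspace (A : E →ₗ[ℂ] E) (ν : ℂ) : Submodule ℂ E))

end Evolution

/-- The component of `φ` with exactly `m` particles in `Γ`. -/
noncomputable def numberComponent {L N : ℕ} (Γ : Finset (Fin L)) (φ : Space L N) (m : ℕ) :
    Space L N :=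
  ⟨WithLp.toLp 2 fun S => if (Γ ∩ S).card = m then (φ : Fock L) S else 0, fun S hS => by
    simp [φ.2 S hS]⟩

theorem numberComponent_apply {L N : ℕ} (Γ : Finset (Fin L)) (φ : Space L N) (m : ℕ)
    (S : Finset (Fin L)) :
    (numberComponent Γ φ m : Fock L) S = if (Γ ∩ S).card = m then (φ : Fock L) S else 0 := rfl

theorem numberIn_numberComponent {L N : ℕ} (Γ : Finset (Fin L)) (φ : Space L N) (m : ℕ) :
    numberIn N Γ (numberComponent Γ φ m) = (m : ℂ) • numberComponent Γ φ m := by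
  apply Subtype.ext
  ext S
  rw [numberIn_apply, numberComponent_apply]
  change _ = (m : ℂ) * (if (Γ ∩ S).card = m then (φ : Fock L) S else 0)
  split_ifs with h
  · rw [h]
  · simp

theorem norm_sq_sub_mul_le_of_numberIn {L N : ℕ} (Γ : Finset (Fin L)) {r d : ℝ} (hd : 0 ≤ d)
    (φ w : Space L N)
    (hw : ∀ S, (w : Fock L) S = (φ : Fock L) S ∨
      (w : Fock L) S = 0 ∧ d ≤ |((Γ ∩ S).card : ℝ) - r|) :
    ‖(φ : Fock L) - (w : Fock L)‖ ^ 2 * d ^ 2 ≤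
      ‖(numberIn N Γ φ : Fock L) - (r : ℂ) • (φ : Fock L)‖ ^ 2 := by
  rw [EuclideanSpace.norm_sq_eq, EuclideanSpace.norm_sq_eq, Finset.sum_mul]
  refine Finset.sum_le_sum fun S _ => ?_
  rw [PiLp.sub_apply, PiLp.sub_apply, PiLp.smul_apply, numberIn_apply, smul_eq_mul, ← sub_mul,
    norm_mul, mul_pow]
  rcases hw S with h | ⟨h0, h⟩
  · rw [h, sub_self, norm_zero, zero_pow two_ne_zero, zero_mul]
    positivity
  · have hcast : ((Γ ∩ S).card : ℂ) - (r : ℂ) = (((Γ ∩ S).card - r : ℝ) : ℂ) := by push_cast; ring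
    rw [h0, sub_zero, mul_comm, hcast, Complex.norm_real, Real.norm_eq_abs]
    gcongr

theorem sum_numberComponent_apply {L N : ℕ} (Γ : Finset (Fin L)) (I : Set ℝ)
    [DecidablePred fun m : ℕ => (m : ℝ) ∈ I] (φ : Space L N) (S : Finset (Fin L)) :
    ((∑ m ∈ (Finset.range (Γ.card + 1)).filter (fun m : ℕ => (m : ℝ) ∈ I),
      numberComponent Γ φ m : Space L N) : Fock L) S =
      if ((Γ ∩ S).card : ℝ) ∈ I then (φ : Fock L) S else 0 := by
  rw [Submodule.coe_sum, WithLp.ofLp_sum, Finset.sum_apply]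
  simp only [numberComponent_apply]
  rw [Finset.sum_ite_eq]
  have : (Γ ∩ S).card < Γ.card + 1 :=
    Nat.lt_succ_of_le (Finset.card_le_card Finset.inter_subset_left)
  simp [this]

theorem projNeq_apply {L N : ℕ} (Γ : Finset (Fin L)) (η : ℝ) (φ : Space L N) :
    projNeq N Γ η φ = φ - projEq N Γ η φ := rfl

theorem norm_sub_spectralProjection_numberIn_le {L N : ℕ} (Γ : Finset (Fin L)) (I : Set ℝ)
    (φ : Space L N) (t : Finset ℕ) (ht : ∀ m ∈ t, (m : ℝ) ∈ I) {w : Space L N}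
    (hw : w = ∑ m ∈ t, numberComponent Γ φ m) :
    ‖φ - spectralProjection (E := Space L N) (numberIn N Γ) I φ‖ ≤ ‖φ - w‖ := by
  have h := norm_sub_spectralProjection_le (E := Space L N) (numberIn N Γ) I φ t
    (ν := fun m => (m : ℝ)) (v := numberComponent Γ φ) (w := w) ht
    (fun m _ => numberIn_numberComponent Γ φ m) hw
  exact h

open Classical in
/-- Chebyshev's inequality for the number of particles in `Γ`. -/
theorem norm_sq_projNeq_mul_le {L N : ℕ} (Γ : Finset (Fin L)) {η : ℝ} (hη : 0 ≤ η)
    (φ : Space L N) :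
    ‖projNeq N Γ η φ‖ ^ 2 * (N * η) ^ 2 ≤
      ‖(numberIn N Γ φ : Fock L) - ((N * relSize Γ : ℝ) : ℂ) • (φ : Fock L)‖ ^ 2 := by
  obtain ⟨I, hI⟩ : ∃ I, I = Set.Icc ((N : ℝ) * (relSize Γ - η)) ((N : ℝ) * (relSize Γ + η)) :=
    ⟨_, rfl⟩
  -- The competitor `w` keeps the configurations with an admissible count in Γ; counts never exceed
  -- |Γ|.
  obtain ⟨w, hw⟩ : ∃ w : Space L N, w = ∑ m ∈ (Finset.range (Γ.card + 1)).filter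
      (fun m : ℕ => (m : ℝ) ∈ I), numberComponent Γ φ m := ⟨_, rfl⟩
  have h1 : ‖projNeq N Γ η φ‖ ≤ ‖φ - w‖ := by
    rw [projNeq_apply, projEq, ← hI]
    exact norm_sub_spectralProjection_numberIn_le Γ I φ _
      (fun m hm => (Finset.mem_filter.mp hm).2) hw
  have h2 : ‖(φ : Fock L) - (w : Fock L)‖ ^ 2 * (N * η) ^ 2 ≤
      ‖(numberIn N Γ φ : Fock L) - ((N * relSize Γ : ℝ) : ℂ) • (φ : Fock L)‖ ^ 2 := by
    refine norm_sq_sub_mul_le_of_numberIn Γ (by positivity) φ w fun S => ?_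
    rw [hw, sum_numberComponent_apply]
    split_ifs with h
    · exact Or.inl rfl
    · rw [hI, Set.mem_Icc, not_and_or, not_le, not_le] at h
      refine Or.inr ⟨rfl, le_abs.mpr ?_⟩
      rcases h with h | h
      · right; linarith
      · left; linarith
  exact (mul_le_mul_of_nonneg_right (pow_le_pow_left₀ (norm_nonneg _) h1 2) (sq_nonneg _)).trans h2

/-! ### The time-averaged variance of the particle number in Γ. -/

section Variance

variable {L : ℕ} [NeZero L] {N : ℕ}

/-- The Fourier mode `(k, l)` of the operator `L² N_Γ`. -/
noncomputable def numberMode (N : ℕ) (Γ : Finset (Fin L)) (p : ZMod L × ZMod L) :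
    Space L N →L[ℂ] Space L N :=
  sectorQuant N (fourierCoeffOf Γ (p.2 - p.1) • modeMatrix p.1 p.2)

/-- For fixed l, the difference l - k runs over all momenta, so Parseval gives L²; the remaining sum
over l gives L · LN. -/
theorem sum_norm_sq_numberMode_le (Γ : Finset (Fin L)) (ψ : Space L N) :
    ∑ p, ‖numberMode N Γ p ψ‖ ^ 2 ≤ L ^ 4 * N * ‖ψ‖ ^ 2 := by
  rw [Fintype.sum_prod_type, Finset.sum_comm]
  calc _ ≤ ∑ l : ZMod L, ∑ k : ZMod L,
        ‖fourierCoeffOf Γ (l - k)‖ ^ 2 * (L * ‖modeAnn l (ψ : Fock L)‖ ^ 2) :=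
        Finset.sum_le_sum fun l _ => Finset.sum_le_sum fun k _ =>
          norm_sq_sectorQuant_modeMatrix_le _ k l ψ
    _ ≤ ∑ l : ZMod L, (L : ℝ) ^ 2 * (L * ‖modeAnn l (ψ : Fock L)‖ ^ 2) := by
        refine Finset.sum_le_sum fun l _ => ?_
        rw [← Finset.sum_mul]
        gcongr
        exact (Equiv.sum_comp (Equiv.subLeft l) fun q => ‖fourierCoeffOf Γ q‖ ^ 2).trans_le
          (sum_norm_sq_fourierCoeffOf_le Γ)
    _ = _ := by
        rw [← Finset.mul_sum, ← Finset.mul_sum, sum_norm_sq_modeAnn]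
        ring

/-- The pairs (k, -k) have gap zero, so averaging does not help. Cauchy–Schwarz suffices, since k ↦
-2k is a bijection for odd prime L and Parseval still applies. -/
theorem sq_sum_norm_numberMode_neg_le (hL : L.Prime) (hL2 : 2 < L) (Γ : Finset (Fin L))
    (ψ : Space L N) :
    (∑ k : ZMod L, ‖numberMode N Γ (k, -k) ψ‖) ^ 2 ≤ L ^ 4 * N * ‖ψ‖ ^ 2 := by
  have := Fact.mk hL
  have hinj : Function.Injective fun k : ZMod L => -k - k := by
    intro k l h
    have h2 : (2 : ZMod L) ≠ 0 := by
      intro h2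
      have h3 : L ∣ 2 := (ZMod.natCast_eq_zero_iff 2 L).mp (by exact_mod_cast h2)
      exact absurd (Nat.le_of_dvd (by norm_num) h3) (by omega)
    refine mul_left_cancel₀ h2 ?_
    change -k - k = -l - l at h
    linear_combination -h
  have hneg : ∑ k : ZMod L, ‖modeAnn (-k) (ψ : Fock L)‖ ^ 2 =
      ∑ k : ZMod L, ‖modeAnn k (ψ : Fock L)‖ ^ 2 :=
    Equiv.sum_comp (Equiv.neg (ZMod L)) fun k => ‖modeAnn k (ψ : Fock L)‖ ^ 2
  calc _ ≤ (∑ k : ZMod L, ‖fourierCoeffOf Γ (-k - k)‖ ^ 2) *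
        ∑ k : ZMod L, (L * ‖modeAnn (-k) (ψ : Fock L)‖ ^ 2) :=
        Finset.sum_sq_le_sum_mul_sum_of_sq_le_mul _ (fun _ _ => by positivity)
          (fun _ _ => by positivity) fun k _ => norm_sq_sectorQuant_modeMatrix_le _ k (-k) ψ
    _ ≤ (L : ℝ) ^ 2 * (L * (L * N * ‖ψ‖ ^ 2)) := by
        rw [(Finite.injective_iff_bijective.mp hinj).sum_comp fun q => ‖fourierCoeffOf Γ q‖ ^ 2,
          ← Finset.mul_sum, hneg, sum_norm_sq_modeAnn]
        gcongr
        exact sum_norm_sq_fourierCoeffOf_le Γ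
    _ = _ := by ring

/-- The frequency of the Fourier mode `(k, l)` of `N_Γ` in the Heisenberg picture. -/
noncomputable def modeGap (p : ZMod L × ZMod L) : ℝ := modeEnergy p.1 - modeEnergy p.2

/-- The pairs of modes with different energies. -/
noncomputable def gapPairs (L : ℕ) [NeZero L] : Finset (ZMod L × ZMod L) :=
  (Finset.univ.filter fun p => p.1 ≠ p.2).filter fun p => ¬p.2 = -p.1

/-- The centred number operator splits into a resonant part l = -k, bounded uniformly in time, and
an oscillating part; (a + b)² ≤ 2a² + 2b² separates them. -/
theorem norm_sq_numberIn_evolve_sub_le (hL : L.Prime) (hL2 : 2 < L) (Γ : Finset (Fin L))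
    (ψ : Space L N) (t : ℝ) :
    (L : ℝ) ^ 4 * ‖(numberIn N Γ (evolve (hamiltonian L N) t ψ) : Fock L) -
        ((N * relSize Γ : ℝ) : ℂ) • ((evolve (hamiltonian L N) t ψ : Space L N) : Fock L)‖ ^ 2 ≤
      2 * (L ^ 4 * N * ‖ψ‖ ^ 2) + 2 * ‖∑ p ∈ gapPairs L,
        Complex.exp (Complex.I * modeGap p * t) • (numberMode N Γ p ψ : Fock L)‖ ^ 2 := by
  set P := Finset.univ.filter fun p : ZMod L × ZMod L => p.1 ≠ p.2
  set φ := evolve (hamiltonian L N) t ψ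
  have h1 : (L : ℝ) ^ 4 * ‖(numberIn N Γ φ : Fock L) - ((N * relSize Γ : ℝ) : ℂ) • (φ : Fock L)‖ ^ 2
      = ‖∑ p ∈ P, numberMode N Γ p φ‖ ^ 2 := by
    have h := congrArg (fun v => ‖v‖ ^ 2) (sum_offDiag_sectorQuant_coe Γ φ)
    simp only [norm_smul, mul_pow, norm_pow, Complex.norm_natCast, ← pow_mul] at h
    exact h.symm
  have h2 : ‖∑ p ∈ P, numberMode N Γ p φ‖ =
      ‖∑ p ∈ P, Complex.exp (Complex.I * modeGap p * t) • numberMode N Γ p ψ‖ :=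
    norm_sum_apply_evolve (E := Space L N) inner_hamiltonian P
      (fun p χ => hamiltonian_sectorQuant_modeMatrix hL2 _ p.1 p.2 χ) t ψ
  have h3 : ‖∑ p ∈ P.filter (fun p => p.2 = -p.1),
      Complex.exp (Complex.I * modeGap p * t) • numberMode N Γ p ψ‖ ^ 2 ≤
      L ^ 4 * N * ‖ψ‖ ^ 2 := by
    refine le_trans ?_ (sq_sum_norm_numberMode_neg_le hL hL2 Γ ψ)
    gcongr
    calc _ ≤ ∑ p ∈ P.filter (fun p => p.2 = -p.1), ‖numberMode N Γ p ψ‖ := by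
          refine (norm_sum_le _ _).trans (Finset.sum_le_sum fun p _ => ?_)
          have : Complex.I * (modeGap p : ℂ) * t = ((modeGap p * t : ℝ) : ℂ) * Complex.I := by
            push_cast; ring
          rw [norm_smul, this, Complex.norm_exp_ofReal_mul_I, one_mul]
      _ ≤ ∑ p ∈ Finset.univ.filter (fun p : ZMod L × ZMod L => p.2 = -p.1),
            ‖numberMode N Γ p ψ‖ :=
          Finset.sum_le_sum_of_subset_of_nonneg
            (Finset.filter_subset_filter _ (Finset.subset_univ _)) fun _ _ _ => norm_nonneg _
      _ = _ := by
          rw [Finset.sum_filter, Fintype.sum_prod_type]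
          refine Finset.sum_congr rfl fun k _ => ?_
          exact (Finset.sum_ite_eq' Finset.univ (-k) fun l => ‖numberMode N Γ (k, l) ψ‖).trans
            (if_pos (Finset.mem_univ _))
  have h4 : ‖∑ p ∈ gapPairs L,
        Complex.exp (Complex.I * modeGap p * t) • (numberMode N Γ p ψ : Fock L)‖ =
      ‖∑ p ∈ gapPairs L, Complex.exp (Complex.I * modeGap p * t) • numberMode N Γ p ψ‖ := by
    conv_rhs => rw [← Submodule.norm_coe, Submodule.coe_sum]
    rfl
  rw [h1, h2, h4, ← Finset.sum_filter_add_sum_filter_not P (fun p => p.2 = -p.1)]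
  set A := ∑ p ∈ P.filter (fun p => p.2 = -p.1),
    Complex.exp (Complex.I * modeGap p * t) • numberMode N Γ p ψ
  change ‖A + ∑ p ∈ gapPairs L, _‖ ^ 2 ≤ _
  set B := ∑ p ∈ gapPairs L, Complex.exp (Complex.I * modeGap p * t) • numberMode N Γ p ψ
  have h5 := norm_add_le A B
  have h6 : ‖A + B‖ ^ 2 ≤ (‖A‖ + ‖B‖) ^ 2 := by gcongr
  nlinarith [sq_nonneg (‖A‖ - ‖B‖)]

theorem exists_tendsto_average_numberMode (hL : L.Prime) (Γ : Finset (Fin L)) (ψ : Space L N) :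
    ∃ a ≤ 4 * (L ^ 4 * N * ‖ψ‖ ^ 2), Tendsto (fun T : ℝ => (1 / T) * ∫ t in (0 : ℝ)..T,
      ‖∑ p ∈ gapPairs L,
        Complex.exp (Complex.I * modeGap p * t) • (numberMode N Γ p ψ : Fock L)‖ ^ 2)
      atTop (nhds a) := by
  obtain ⟨a, ha, h⟩ := exists_tendsto_average_norm_sq (gapPairs L) modeGap
    (fun p => (numberMode N Γ p ψ : Fock L)) 4 fun p hp => by
      have hp' := Finset.mem_filter.mp hp
      refine card_filter_modeEnergy_sub_eq_le hL (Finset.mem_filter.mp hp'.1).2 ?_ _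
      intro hc
      exact hp'.2 (by rw [hc, neg_neg])
  refine ⟨a, ha.trans ?_, h⟩
  push_cast
  gcongr
  refine le_trans ?_ (sum_norm_sq_numberMode_le Γ ψ)
  exact Finset.sum_le_sum_of_subset_of_nonneg (Finset.subset_univ _) fun _ _ _ => sq_nonneg _

end Variance

end FreeFermi

/-! ### Assembly of the estimates. -/

open FreeFermi in
theorem mainTheorem5 (L N : ℕ) (hL : L.Prime) (hN : 46 ≤ N) (hNL : (N : ℝ) < (L : ℝ) / 4)
    (Γ : Finset (Fin L)) (hΓ : IsInterval Γ)
    (η : ℝ) (hη : 2 * (Real.log N + 1) / N < η)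
    (ε δ : ℝ) (hε : 0 < ε) (hδ : 0 < δ) (hεδ : 32 * Real.log N / (η ^ 2 * N) ≤ ε * δ)
    (ψ₀ : Space L N) (hψ₀ : ‖ψ₀‖ = 1) :
    ForMostTimes δ fun t : ℝ => ‖projNeq N Γ η (evolve (hamiltonian L N) t ψ₀)‖ ^ 2 < ε := by
  have hN' : (46 : ℝ) ≤ N := by exact_mod_cast hN
  have hL2 : 2 < L := by
    have : (2 : ℝ) < L := by linarith
    exact_mod_cast this
  have : NeZero L := ⟨hL.ne_zero⟩
  have hLpos : (0 : ℝ) < L := by linarith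
  have hNpos : (0 : ℝ) < N := by linarith
  have hlog : 1 ≤ Real.log N := by
    rw [Real.le_log_iff_exp_le hNpos]
    linarith [Real.exp_one_lt_d9]
  have hηpos : 0 < η := lt_of_le_of_lt (by positivity) hη
  obtain ⟨a, ha, hlim⟩ := exists_tendsto_average_numberMode hL Γ ψ₀
  rw [hψ₀] at ha
  set B : ℝ → ℝ := fun t => ‖∑ p ∈ gapPairs L,
    Complex.exp (Complex.I * modeGap p * t) • (numberMode N Γ p ψ₀ : Fock L)‖ ^ 2 with hB
  have hBcont : Continuous B := by fun_prop
  -- Here L⁴ undoes the normalization of the modes and (Nη)² is the Chebyshev denominator.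
  set c : ℝ := (L : ℝ) ^ 4 * (N * η) ^ 2 with hc
  have hcpos : 0 < c := by positivity
  refine forMostTimes_of_average_le (g := fun t => (2 * (L ^ 4 * N) + 2 * B t) / c)
    (a := (2 * (L ^ 4 * N) + 2 * a) / c) ?_ (by fun_prop) (fun t => sq_nonneg _) ?_ hε ?_ ?_
  · have h := continuous_evolve (E := Space L N) (hamiltonian L N) ψ₀
    exact ((projNeq N Γ η).continuous.comp h).norm.pow 2
  · intro t
    rw [le_div_iff₀ hcpos]
    have h1 := norm_sq_projNeq_mul_le Γ hηpos.le (evolve (hamiltonian L N) t ψ₀)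
    have h2 := norm_sq_numberIn_evolve_sub_le hL hL2 Γ ψ₀ t
    rw [hψ₀, one_pow, mul_one] at h2
    refine le_trans ?_ h2
    rw [hc, mul_left_comm]
    gcongr
  · have h1 : Tendsto (fun T : ℝ => (2 * (L ^ 4 * N) + 2 * ((1 / T) * ∫ t in (0 : ℝ)..T, B t)) / c)
        atTop (nhds ((2 * (L ^ 4 * N) + 2 * a) / c)) :=
      ((hlim.const_mul 2).const_add _).div_const c
    refine h1.congr' ?_
    filter_upwards [eventually_ne_atTop 0] with T hT
    rw [intervalIntegral.integral_div, intervalIntegral.integral_add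
      (continuous_const.intervalIntegrable _ _) ((hBcont.const_mul 2).intervalIntegrable _ _),
      intervalIntegral.integral_const, intervalIntegral.integral_const_mul]
    simp only [sub_zero, smul_eq_mul]
    field_simp
  · refine le_trans ?_ hεδ
    -- The left side is at most (2 + 2·4) L⁴N, and 10 ≤ 32 ln N because ln N ≥ 1.
    have h1 : 2 * ((L : ℝ) ^ 4 * N) + 2 * a ≤ 32 * Real.log N * ((L : ℝ) ^ 4 * N) := by
      have h2 : (0 : ℝ) < L ^ 4 * N := by positivity
      nlinarith
    calc _ ≤ 32 * Real.log N * ((L : ℝ) ^ 4 * N) / c := by gcongr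
      _ = _ := by rw [hc]; field_simp
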